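/- Let $N\ge 1$ and $K\ge 1$. There are $N$ non-communicating databases, each storing the same $K$ independent messages $W_1,\dots,W_K$ of $L$ bits each, $H(W_i)=L$. For a caching ratio $r\in[0,1]$, a user stores, before it knows which message it will want, the values $Z$ of $Lr$ bits (rounded down if $Lr$ is not an integer) of every message, at positions $\mathbb H$ that are random and independent of the messages (with an arbitrary joint law, for instance uniform and independent over the messages). To retrieve $W_k$, the user sends queries $Q_1^{[k]},\dots,Q_N^{[k]}$ such that $(\mathbb H,Q_{1}^{[k]},\dots,Q_N^{[k]})$ is independent of $(W_1,\dots,W_K)$; database $n$ replies with $A_n^{[k]}$, a function of $Q_n^{[k]}$ and $W_1,\dots,W_K$. Queries and answers take finitely many values. Privacy: for every $n$ the law of $(Q_n^{[k]},A_n^{[k]},W_1,\dots,W_K)$ does not depend on $k$. The download cost is $D=\sum_{n=1}^N H(A_n^{[k]})$, which by privacy does not depend on $k$. A number $d$ is an achievable normalized download cost at caching ratio $r$ if there are such schemes with message lengths $L\to\infty$, with $H(W_k\mid Z,\mathbb H,Q_{1:N}^{[k]},A_{1:N}^{[k]})=o(L)$ for every $k$, and with $D/L\to d$. Let $D^*(r)$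 be the infimum of the achievable $d$. **Theorem 2 (inner bound).** For every $r\in[0,1]$, $$D^*(r)\ \ge\ \tilde D(r)=\max_{i\in\{2,\dots,K+1\}} f_i(r),\qquad f_i(r)=(1-r)\sum_{j=0}^{K+1-i}\frac1{N^j}-r\sum_{j=0}^{K-i}\frac{K+1-i-j}{N^j},$$ where the last sum is empty for $i=K+1$. The bound $\tilde D$ is piecewise linear on $[0,1]$ with $K$ segments: with $\tilde r_0=0$ and $\tilde r_s=\frac1{1+N+\cdots+N^{K-s}}$ for $1\le s\le K$ one has $0=\tilde r_0<\tilde r_1<\cdots<\tilde r_K=1$, $\tilde D=f_{s+2}$ on $[\tilde r_s,\tilde r_{s+1}]$ for $0\le s<K$, and the slope of $f_{s+2}$ is strictly smaller than that of $f_{s+3}$ for $0\le s<K-1$. -/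

import Mathlib

open MeasureTheory ProbabilityTheory Filter Topology

noncomputable section

namespace CachePIR

/-- Shannon entropy, in bits, of a random variable with finitely many values. -/
def entropy {Ω α : Type*} [MeasurableSpace Ω] [Fintype α] (P : Measure Ω) (X : Ω → α) : ℝ :=
  -∑ x, P.real {ω | X ω = x} * Real.logb 2 (P.real {ω | X ω = x})

/-- Conditional Shannon entropy `H(X | Y)`, in bits, of random variables with finitely many
values: `∑ P(X = x, Y = y) log₂ (P(Y = y) / P(X = x, Y = y))`, where terms with
`P(X = x, Y = y) = 0` vanish. -/
def condEntropy {Ω α β : Type*} [MeasurableSpace Ω] [Fintype α] [Fintype β] (P : Measure Ω)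
    (X : Ω → α) (Y : Ω → β) : ℝ :=
  ∑ x, ∑ y, P.real {ω | X ω = x ∧ Y ω = y} *
    Real.logb 2 (P.real {ω | Y ω = y} / P.real {ω | X ω = x ∧ Y ω = y})

/-- A private information retrieval scheme with uncoded prefetching that the databases do not
know: `N` databases, `K` messages of `L` bits each, and `c` cached bits of every message.
The reliability of the decoding is a separate, asymptotic requirement. -/
structure Scheme (N K L c : ℕ) where
  /-- the underlying probability space -/
  Ω : Type
  [measΩ : MeasurableSpace Ω]
  P : Measure Ω
  [probP : IsProbabilityMeasure P]
  /-- `W i` is the message number `i` -/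
  W : Fin K → Ω → (Fin L → Bool)
  /-- `idx ω i` lists, in increasing order, the positions of the `c` cached bits of
  message `i` -/
  idx : Ω → Fin K → Fin c → Fin L
  /-- the sizes of the finite query and answer alphabets -/
  q : ℕ
  a : ℕ
  /-- `Q k n` is the query to database `n` when message `k` is desired -/
  Q : Fin K → Fin N → Ω → Fin q
  /-- `A k n` is the answer of database `n` when message `k` is desired -/
  A : Fin K → Fin N → Ω → Fin a
  measurable_W : ∀ i, Measurable (W i)
  measurable_idx : Measurable idx
  measurable_Q : ∀ k n, Measurable (Q k n)
  measurable_A : ∀ k n, Measurable (A k n)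
  /-- the messages are independent -/
  indep_W : iIndepFun W P
  /-- every message has `L` bits of entropy -/
  entropy_W : ∀ i, entropy P (W i) = L
  strictMono_idx : ∀ ω i, StrictMono (idx ω i)
  /-- the cached positions and the queries are chosen independently of the messages -/
  indep_query : ∀ k,
    IndepFun (fun ω => (idx ω, fun n => Q k n ω)) (fun ω i => W i ω) P
  /-- privacy: the view of a single database does not depend on the desired message -/
  privacy : ∀ n k k',
    IdentDistrib (fun ω => (Q k n ω, A k n ω, fun i => W i ω))
      (fun ω => (Q k' n ω, A k' n ω, fun i => W i ω)) P P
  /-- an answer is a function of the query and the messages -/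
  answer : ∀ k n, condEntropy P (A k n) (fun ω => (Q k n ω, fun i => W i ω)) = 0

attribute [instance] Scheme.measΩ Scheme.probP

namespace Scheme

variable {N K L c : ℕ} (S : Scheme N K L c)

/-- The cache content: the values of the cached bits of every message. -/
def Z (ω : S.Ω) : Fin K → Fin c → Bool := fun i j => S.W i ω (S.idx ω i j)

/-- The uncertainty about the desired message `k` that is left to the user, who knows the cache
content, the cached positions, the queries and the answers. -/
def equivocation (k : Fin K) : ℝ :=
  condEntropy S.P (S.W k)
    (fun ω => (S.Z ω, S.idx ω, (fun n => S.Q k n ω), (fun n => S.A k n ω)))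

/-- The expected number of downloaded bits when message `k` is desired. -/
def downloadCost (k : Fin K) : ℝ := ∑ n, entropy S.P (S.A k n)

end Scheme

/-- `d` is an achievable normalized download cost at caching ratio `r`: there are schemes with
message lengths `L m → ∞` that cache `r * L m` bits (rounded down) of each message,
whose equivocation is `o(L m)` for each desired message, and whose download cost per message bit
tends to `d`. -/
def Achievable (N K : ℕ) (r d : ℝ) : Prop :=
  ∃ (L : ℕ → ℕ) (S : ∀ m, Scheme N K (L m) ⌊r * (L m : ℝ)⌋₊),
    Tendsto L atTop atTop ∧
    (∀ k, Tendsto (fun m => (S m).equivocation k / (L m : ℝ)) atTop (𝓝 0)) ∧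
    (∀ k, Tendsto (fun m => (S m).downloadCost k / (L m : ℝ)) atTop (𝓝 d))

/-- The optimal normalized download cost `D*(r)`: the infimum of the achievable ones, taken in
the extended reals. -/
def optimalCost (N K : ℕ) (r : ℝ) : EReal :=
  sInf {x : EReal | ∃ d : ℝ, Achievable N K r d ∧ x = (d : EReal)}

/-- The affine function of `r` that belongs to the index `i`, for `2 ≤ i ≤ K + 1`:
`(1 - r) ∑_{j=0}^{K+1-i} 1/N^j - r ∑_{j=0}^{K-i} (K+1-i-j)/N^j`;
the second sum is empty for `i = K + 1`. -/
def innerLine (N K i : ℕ) (r : ℝ) : ℝ :=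
  (1 - r) * ∑ j ∈ Finset.range (K + 2 - i), 1 / (N : ℝ) ^ j
    - r * ∑ j ∈ Finset.range (K + 1 - i), ((K : ℝ) + 1 - i - j) / (N : ℝ) ^ j

/-- The inner bound, the maximum of these functions over `i ∈ {2, …, K + 1}`. -/
def innerBound (N K : ℕ) (hK : 1 ≤ K) (r : ℝ) : ℝ :=
  (Finset.Icc 2 (K + 1)).sup' (Finset.nonempty_Icc.2 (Nat.succ_le_succ hK))
    (fun i => innerLine N K i r)

/-- The end points of the segments: `0` for `s = 0`, and `1 / (1 + N + ⋯ + N^(K-s))` for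
`1 ≤ s ≤ K`. -/
def corner (N K s : ℕ) : ℝ :=
  if s = 0 then 0 else 1 / ∑ j ∈ Finset.range (K - s + 1), (N : ℝ) ^ j

end CachePIR

end

/-! Number the messages from 0 and let T_k(t) be the entropy of all answers for demand k, given the
cache, the cached positions, the queries and the first t messages (`answerEntropy`). Three
inequalities carry the bound, with c the number of cached bits per message.

Decoding (`decoding_bound`): given the first k messages and the cache, message k still has at least
L - c unknown bits, and the answers reveal all but o(L) of them. So T_k(k) is at least L - c - o(L)
+ T_k(k+1).

Change of demand (`answerEntropy_recursion`): T_k(k+1) is at least the entropy of one answer A_n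
given Q_n and the first k+1 messages, minus the (K-1-k)c bits that the cache may hold of the other
messages. By privacy this local entropy is the same for demand k+1, and there its sum over the N
databases is at least T_{k+1}(k+1). This produces the factor 1/N.

Alternating the two until the messages are exhausted gives the recursion `innerLine_eq_succ` of the
lines, up to o(L). Starting from demand k yields the line of index k+2; all K starting points
together yield the maximum.

The shape of the maximum follows from `innerLine_sub_succ`: the difference of consecutive lines is
decreasing in r and vanishes at a corner, and the corners increase. -/

noncomputable section

namespace CachePIR

/-! ### Entropy of finitely valued random variables -/

section Entropy

variable {Ω α β γ δ : Type*} [MeasurableSpace Ω] {P : Measure Ω} {X : Ω → α} {Y : Ω → β}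
  {Z : Ω → γ}

/-- All events that concern the value of `X` are measurable. -/
def Observable (X : Ω → α) : Prop := ∀ s : Set α, MeasurableSet (X ⁻¹' s)

/-- Since `Observable` quantifies over all subsets, it passes to functions of X with no
measurability condition on the function. Tuples of observables can thus be regrouped and projected
freely. -/
theorem Observable.factorsThrough (hX : Observable X) (h : Y.FactorsThrough X) : Observable Y := by
  intro s
  have : Y ⁻¹' s = X ⁻¹' (X '' (Y ⁻¹' s)) := by
    ext ω
    constructor
    · intro hω
      exact ⟨ω, hω, rfl⟩
    · rintro ⟨ω', hω', he⟩
      have := h he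
      simpa [this] using hω'
  rw [this]
  exact hX _

theorem Observable.comp (hX : Observable X) (f : α → β) : Observable (fun ω => f (X ω)) :=
  hX.factorsThrough fun _ _ h => congrArg f h

theorem real_le_real_comp [IsProbabilityMeasure P] (f : α → β) (a : α) :
    P.real {ω | X ω = a} ≤ P.real {ω | f (X ω) = f a} :=
  measureReal_mono fun _ h => congrArg f h

variable [Fintype α]

theorem Observable.of_measurable [MeasurableSpace α] [MeasurableSingletonClass α]
    (h : Measurable X) : Observable X :=
  fun s => h s.toFinite.measurableSet

theorem entropy_eq_of_identDistrib [MeasurableSpace α] [MeasurableSingletonClass α]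
    {X' : Ω → α} (h : IdentDistrib X X' P P) : entropy P X = entropy P X' := by
  unfold entropy
  congr 1
  refine Finset.sum_congr rfl fun x _ => ?_
  have : P.real {ω | X ω = x} = P.real {ω | X' ω = x} :=
    congrArg ENNReal.toReal (h.measure_mem_eq (measurableSet_singleton x))
  rw [this]

variable [IsProbabilityMeasure P]

theorem real_comp_eq_sum [DecidableEq β] (hX : Observable X) (f : α → β) (b : β) :
    P.real {ω | f (X ω) = b} = ∑ a with f a = b, P.real {ω | X ω = a} := by
  have : {ω | f (X ω) = b} = ⋃ a ∈ Finset.univ.filter (fun a => f a = b), {ω | X ω = a} := by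
    ext ω
    simp
  rw [this, measureReal_biUnion_finset]
  · intro a _ a' _ h
    refine Set.disjoint_left.2 fun ω h1 h2 => h ?_
    simp only [Set.mem_ofPred_eq] at h1 h2
    rw [← h1, ← h2]
  · intro a _
    exact hX {a}

variable [Fintype β] [Fintype γ] [Fintype δ]

theorem Observable.prodMk (hX : Observable X) (hY : Observable Y) :
    Observable (fun ω => (X ω, Y ω)) := by
  intro s
  have : (fun ω => (X ω, Y ω)) ⁻¹' s = ⋃ p ∈ s, X ⁻¹' {p.1} ∩ Y ⁻¹' {p.2} := by
    ext ω
    simp only [Set.mem_preimage, Set.mem_iUnion, Set.mem_inter_iff, Set.mem_singleton_iff,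
      exists_prop]
    constructor
    · intro h
      exact ⟨_, h, rfl, rfl⟩
    · rintro ⟨⟨a, b⟩, h, rfl, rfl⟩
      exact h
  rw [this]
  exact MeasurableSet.biUnion s.to_countable fun p _ => (hX _).inter (hY _)

theorem sum_real_eq_one (hX : Observable X) : ∑ a, P.real {ω | X ω = a} = 1 := by
  have := real_comp_eq_sum (P := P) hX (fun _ => ()) ()
  simpa using this.symm

/-- The entropy of a function of `X`, as an expectation over the values of `X`. -/
theorem entropy_comp (hX : Observable X) (f : α → β) :
    entropy P (fun ω => f (X ω)) =
      -∑ a, P.real {ω | X ω = a} * Real.logb 2 (P.real {ω | f (X ω) = f a}) := by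
  classical
  unfold entropy
  congr 1
  rw [← Finset.sum_fiberwise_of_maps_to (t := Finset.univ) (g := f) (by simp)]
  refine Finset.sum_congr rfl fun b _ => ?_
  rw [real_comp_eq_sum (P := P) hX f b, Finset.sum_mul, ← real_comp_eq_sum (P := P) hX f b]
  refine Finset.sum_congr rfl fun a ha => ?_
  simp only [Finset.mem_filter, Finset.mem_univ, true_and] at ha
  rw [ha]

theorem entropy_comp_le (hX : Observable X) (f : α → β) :
    entropy P (fun ω => f (X ω)) ≤ entropy P X := by
  rw [entropy_comp hX]
  unfold entropy
  refine neg_le_neg (Finset.sum_le_sum fun a _ => ?_)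
  rcases (measureReal_nonneg (μ := P) (s := {ω | X ω = a})).eq_or_lt with h | h
  · simp [← h]
  · exact mul_le_mul_of_nonneg_left
      (Real.logb_le_logb_of_le one_lt_two h (real_le_real_comp f a)) h.le

theorem entropy_le_of_factorsThrough (hX : Observable X) (h : Y.FactorsThrough X) :
    entropy P Y ≤ entropy P X := by
  classical
  obtain ⟨ω₀⟩ : Nonempty Ω := nonempty_of_isProbabilityMeasure P
  have : Nonempty β := ⟨Y ω₀⟩
  obtain ⟨f, rfl⟩ := (Function.factorsThrough_iff Y).1 h
  exact entropy_comp_le hX f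

theorem entropy_eq_of_factorsThrough (hX : Observable X) (h : Y.FactorsThrough X)
    (h' : X.FactorsThrough Y) : entropy P Y = entropy P X :=
  le_antisymm (entropy_le_of_factorsThrough hX h)
    (entropy_le_of_factorsThrough (hX.factorsThrough h) h')

/-- The chain rule. -/
theorem condEntropy_eq (hX : Observable X) (hY : Observable Y) :
    condEntropy P X Y = entropy P (fun ω => (X ω, Y ω)) - entropy P Y := by
  have h1 := entropy_comp (P := P) (hX.prodMk hY) Prod.snd
  simp only at h1
  rw [h1, entropy, condEntropy, ← Fintype.sum_prod_type', neg_sub_neg, ← Finset.sum_sub_distrib]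
  refine Finset.sum_congr rfl fun p _ => ?_
  obtain ⟨x, y⟩ := p
  simp only [Prod.mk.injEq]
  rcases (measureReal_nonneg (μ := P) (s := {ω | X ω = x ∧ Y ω = y})).eq_or_lt with h | h
  · simp [← h]
  · have h2 : 0 < P.real {ω | Y ω = y} :=
      h.trans_le (measureReal_mono fun ω hω => hω.2)
    rw [Real.logb_div h2.ne' h.ne', mul_sub]

theorem condEntropy_nonneg (hX : Observable X) (hY : Observable Y) : 0 ≤ condEntropy P X Y := by
  rw [condEntropy_eq hX hY, sub_nonneg]
  exact entropy_comp_le (hX.prodMk hY) Prod.snd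

/-- Gibbs' inequality. -/
theorem sum_mul_logb_div_le {ι : Type*} (s : Finset ι) (p q : ι → ℝ) (hp : ∀ i ∈ s, 0 ≤ p i)
    (hq : ∀ i ∈ s, 0 ≤ q i) (hpq : ∀ i ∈ s, q i = 0 → p i = 0) :
    ∑ i ∈ s, p i * Real.logb 2 (q i / p i) ≤ (∑ i ∈ s, q i - ∑ i ∈ s, p i) / Real.log 2 := by
  rw [← Finset.sum_sub_distrib, Finset.sum_div]
  refine Finset.sum_le_sum fun i hi => ?_
  have hl : 0 < Real.log 2 := Real.log_pos one_lt_two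
  rcases (hp i hi).eq_or_lt with h | h
  · simpa [← h] using div_nonneg (hq i hi) hl.le
  · have hqi : 0 < q i := (hq i hi).lt_of_ne fun h0 => h.ne' (hpq i hi h0.symm)
    have := Real.log_le_sub_one_of_pos (div_pos hqi h)
    rw [Real.logb, ← mul_div_assoc]
    refine div_le_div_of_nonneg_right ?_ hl.le
    calc p i * Real.log (q i / p i) ≤ p i * (q i / p i - 1) :=
          mul_le_mul_of_nonneg_left this h.le
      _ = q i - p i := by field_simp

/-- Gibbs' inequality against the uniform law. -/
theorem entropy_le_logb_card (hX : Observable X) :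
    entropy P X ≤ Real.logb 2 (Fintype.card α) := by
  obtain ⟨ω₀⟩ : Nonempty Ω := nonempty_of_isProbabilityMeasure P
  have : Nonempty α := ⟨X ω₀⟩
  have hc : (0 : ℝ) < Fintype.card α := by exact_mod_cast Fintype.card_pos
  have h := sum_mul_logb_div_le Finset.univ (fun a => P.real {ω | X ω = a})
    (fun _ => 1 / (Fintype.card α : ℝ)) (fun _ _ => measureReal_nonneg)
    (fun _ _ => by positivity) (fun _ _ h0 => absurd h0 (by positivity))
  have h1 : ∑ _a : α, 1 / (Fintype.card α : ℝ) = 1 := by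
    rw [Finset.sum_const, Finset.card_univ, nsmul_eq_mul]
    field_simp
  rw [h1, sum_real_eq_one hX, sub_self, zero_div] at h
  have h2 : entropy P X - Real.logb 2 (Fintype.card α) =
      ∑ a, P.real {ω | X ω = a} *
        Real.logb 2 (1 / (Fintype.card α : ℝ) / P.real {ω | X ω = a}) := by
    have h3 : Real.logb 2 (Fintype.card α) =
        ∑ a, P.real {ω | X ω = a} * Real.logb 2 (Fintype.card α) := by
      rw [← Finset.sum_mul, sum_real_eq_one hX, one_mul]
    rw [h3, entropy, ← Finset.sum_neg_distrib, ← Finset.sum_sub_distrib]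
    refine Finset.sum_congr rfl fun a _ => ?_
    rcases (measureReal_nonneg (μ := P) (s := {ω | X ω = a})).eq_or_lt with h | h
    · simp [← h]
    · rw [Real.logb_div (by positivity) h.ne', one_div, Real.logb_inv]
      ring
  linarith

theorem entropy_pi_bool_le {ι κ : Type*} [Fintype ι] [DecidableEq ι] [Fintype κ] [DecidableEq κ]
    {X : Ω → ι → κ → Bool} (hX : Observable X) :
    entropy P X ≤ Fintype.card ι * Fintype.card κ := by
  refine (entropy_le_logb_card hX).trans_eq ?_
  rw [Fintype.card_fun, Fintype.card_fun, Fintype.card_bool, ← pow_mul]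
  push_cast
  rw [Real.logb_pow, Real.logb_self_eq_one one_lt_two]
  push_cast
  ring

/-- This is nonnegativity of I(X; Y | Z): Gibbs' inequality compares the joint law with the one that
makes X and Y conditionally independent given Z. -/
theorem entropy_submodular_triple (hX : Observable X) (hY : Observable Y) (hZ : Observable Z) :
    entropy P (fun ω => (X ω, Y ω, Z ω)) + entropy P Z ≤
      entropy P (fun ω => (X ω, Z ω)) + entropy P (fun ω => (Y ω, Z ω)) := by
  classical
  have hT : Observable (fun ω => (X ω, Y ω, Z ω)) := hX.prodMk (hY.prodMk hZ)
  have hXZ : Observable (fun ω => (X ω, Z ω)) := hX.prodMk hZ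
  have hYZ : Observable (fun ω => (Y ω, Z ω)) := hY.prodMk hZ
  set p : α × β × γ → ℝ := fun t => P.real {ω | (X ω, Y ω, Z ω) = t} with hp
  set a : α × γ → ℝ := fun t => P.real {ω | (X ω, Z ω) = t} with ha
  set b : β × γ → ℝ := fun t => P.real {ω | (Y ω, Z ω) = t} with hb
  set c : γ → ℝ := fun z => P.real {ω | Z ω = z} with hc
  have ePX : entropy P (fun ω => (X ω, Z ω)) = -∑ t, p t * Real.logb 2 (a (t.1, t.2.2)) :=
    entropy_comp (P := P) hT (fun t => (t.1, t.2.2))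
  have ePY : entropy P (fun ω => (Y ω, Z ω)) = -∑ t, p t * Real.logb 2 (b t.2) :=
    entropy_comp (P := P) hT (fun t => t.2)
  have ePZ : entropy P Z = -∑ t, p t * Real.logb 2 (c t.2.2) :=
    entropy_comp (P := P) hT (fun t => t.2.2)
  have eP : entropy P (fun ω => (X ω, Y ω, Z ω)) = -∑ t, p t * Real.logb 2 (p t) := rfl
  have p0 : ∀ t, 0 ≤ p t := fun t => measureReal_nonneg
  have a0 : ∀ t, 0 ≤ a t := fun t => measureReal_nonneg
  have b0 : ∀ t, 0 ≤ b t := fun t => measureReal_nonneg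
  have c0 : ∀ t, 0 ≤ c t := fun t => measureReal_nonneg
  have pa : ∀ t, p t ≤ a (t.1, t.2.2) := fun t =>
    real_le_real_comp (X := fun ω => (X ω, Y ω, Z ω)) (fun t => (t.1, t.2.2)) t
  have pb : ∀ t, p t ≤ b t.2 := fun t =>
    real_le_real_comp (X := fun ω => (X ω, Y ω, Z ω)) (fun t => t.2) t
  have pc : ∀ t, p t ≤ c t.2.2 := fun t =>
    real_le_real_comp (X := fun ω => (X ω, Y ω, Z ω)) (fun t => t.2.2) t
  have sa : ∀ z, ∑ x, a (x, z) = c z := by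
    intro z
    have := real_comp_eq_sum (P := P) hXZ Prod.snd z
    simp only at this
    rw [hc]
    simp only
    rw [this, Finset.sum_filter, Fintype.sum_prod_type]
    simp [ha]
  have sb : ∀ z, ∑ x, b (x, z) = c z := by
    intro z
    have := real_comp_eq_sum (P := P) hYZ Prod.snd z
    simp only at this
    rw [hc]
    simp only
    rw [this, Finset.sum_filter, Fintype.sum_prod_type]
    simp [hb]
  have key := sum_mul_logb_div_le Finset.univ p (fun t => a (t.1, t.2.2) * b t.2 / c t.2.2)
    (fun t _ => p0 t) (fun t _ => div_nonneg (mul_nonneg (a0 _) (b0 _)) (c0 _)) (by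
      intro t _ h
      by_contra hne
      have hpos : 0 < p t := (p0 t).lt_of_ne (Ne.symm hne)
      exact absurd h (div_pos (mul_pos (hpos.trans_le (pa t)) (hpos.trans_le (pb t)))
        (hpos.trans_le (pc t))).ne')
  have sq : ∑ t : α × β × γ, a (t.1, t.2.2) * b t.2 / c t.2.2 = 1 := by
    rw [Fintype.sum_prod_type]
    simp only [Fintype.sum_prod_type]
    have : ∀ x, ∑ y, ∑ z, a (x, z) * b (y, z) / c z = ∑ z, a (x, z) := by
      intro x
      rw [Finset.sum_comm]
      refine Finset.sum_congr rfl fun z _ => ?_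
      rw [← Finset.sum_div, ← Finset.mul_sum, sb]
      -- Division by c z = 0 gives 0, which agrees with a (x, z) because a (x, z) ≤ c z.
      by_cases hz : c z = 0
      · have : a (x, z) = 0 := by
          refine le_antisymm ?_ (a0 _)
          rw [← hz, ← sa z]
          exact Finset.single_le_sum (f := fun x => a (x, z)) (fun x _ => a0 _)
            (Finset.mem_univ x)
        simp [this]
      · field_simp
    rw [Finset.sum_congr rfl fun x _ => this x, Finset.sum_comm]
    simp only [sa]
    exact sum_real_eq_one hZ
  rw [sq, sum_real_eq_one hT, sub_self, zero_div] at key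
  have e : ∑ t, p t * Real.logb 2 (a (t.1, t.2.2) * b t.2 / c t.2.2 / p t) =
      ∑ t, (p t * Real.logb 2 (a (t.1, t.2.2)) + p t * Real.logb 2 (b t.2)
        - p t * Real.logb 2 (c t.2.2) - p t * Real.logb 2 (p t)) := by
    refine Finset.sum_congr rfl fun t _ => ?_
    rcases (p0 t).eq_or_lt with h | h
    · simp [← h]
    · have h1 := (h.trans_le (pa t)).ne'
      have h2 := (h.trans_le (pb t)).ne'
      have h3 := (h.trans_le (pc t)).ne'
      rw [Real.logb_div (div_ne_zero (mul_ne_zero h1 h2) h3) h.ne',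
        Real.logb_div (mul_ne_zero h1 h2) h3, Real.logb_mul h1 h2]
      ring
  rw [e, Finset.sum_sub_distrib, Finset.sum_sub_distrib, Finset.sum_add_distrib] at key
  rw [ePX, ePY, ePZ, eP]
  linarith

/-- Submodularity: `B` is a function of `(X, Y)`, and `C` both of `X` and of `Y`. -/
theorem entropy_submodular {B : Ω → γ} {C : Ω → δ} (hX : Observable X) (hY : Observable Y)
    (hB : ∀ ω ω', X ω = X ω' → Y ω = Y ω' → B ω = B ω')
    (hCX : ∀ ω ω', X ω = X ω' → C ω = C ω') (hCY : ∀ ω ω', Y ω = Y ω' → C ω = C ω') :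
    entropy P B + entropy P C ≤ entropy P X + entropy P Y := by
  have hC : Observable C := hX.factorsThrough fun _ _ h => hCX _ _ h
  have h := entropy_submodular_triple (P := P) hX hY hC
  have h1 : entropy P B ≤ entropy P (fun ω => (X ω, Y ω, C ω)) :=
    entropy_le_of_factorsThrough (hX.prodMk (hY.prodMk hC)) fun ω ω' h => by
      simp only [Prod.mk.injEq] at h
      exact hB _ _ h.1 h.2.1
  have h2 : entropy P (fun ω => (X ω, C ω)) ≤ entropy P X :=
    entropy_le_of_factorsThrough hX fun ω ω' h => by rw [h, hCX _ _ h]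
  have h3 : entropy P (fun ω => (Y ω, C ω)) ≤ entropy P Y :=
    entropy_le_of_factorsThrough hY fun ω ω' h => by rw [h, hCY _ _ h]
  linarith

theorem entropy_const (a : α) : entropy P (fun _ : Ω => a) = 0 := by
  unfold entropy
  rw [Finset.sum_eq_zero, neg_zero]
  intro x _
  by_cases h : a = x <;> simp [h]

/-- Subadditivity. -/
theorem entropy_le_add {B : Ω → γ} (hX : Observable X) (hY : Observable Y)
    (hB : ∀ ω ω', X ω = X ω' → Y ω = Y ω' → B ω = B ω') :
    entropy P B ≤ entropy P X + entropy P Y := by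
  have := entropy_submodular (P := P) (C := fun _ => ()) hX hY hB (by simp) (by simp)
  rwa [entropy_const, add_zero] at this

theorem entropy_prod_of_indepFun [MeasurableSpace α] [MeasurableSpace β]
    [MeasurableSingletonClass α] [MeasurableSingletonClass β] (hX : Observable X)
    (hY : Observable Y) (h : IndepFun X Y P) :
    entropy P (fun ω => (X ω, Y ω)) = entropy P X + entropy P Y := by
  have h1 := entropy_comp (P := P) (hX.prodMk hY) Prod.fst
  have h2 := entropy_comp (P := P) (hX.prodMk hY) Prod.snd
  simp only at h1 h2
  rw [h1, h2, entropy, ← neg_add, ← Finset.sum_add_distrib]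
  congr 1
  refine Finset.sum_congr rfl fun p _ => ?_
  obtain ⟨x, y⟩ := p
  have hm : P.real {ω | (X ω, Y ω) = (x, y)} = P.real {ω | X ω = x} * P.real {ω | Y ω = y} := by
    have := h.measure_inter_preimage_eq_mul {x} {y} (measurableSet_singleton x)
      (measurableSet_singleton y)
    have he : {ω | (X ω, Y ω) = (x, y)} = X ⁻¹' {x} ∩ Y ⁻¹' {y} := by
      ext ω
      simp
    rw [he, Measure.real, this, ENNReal.toReal_mul]
    rfl
  rcases (measureReal_nonneg (μ := P) (s := {ω | X ω = x})).eq_or_lt with h | h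
  · rw [hm, ← h]
    simp
  rcases (measureReal_nonneg (μ := P) (s := {ω | Y ω = y})).eq_or_lt with h' | h'
  · rw [hm, ← h']
    simp
  rw [hm, Real.logb_mul h.ne' h'.ne']
  ring

/-- Subadditivity of the conditional entropy of finitely many random variables. -/
theorem entropy_pi_sub_le {ι : Type*} [Fintype ι] [DecidableEq ι] {A : ι → Ω → α}
    (hA : ∀ i, Observable (A i)) (hY : Observable Y) :
    entropy P (fun ω => ((fun i => A i ω), Y ω)) - entropy P Y ≤
      ∑ i, (entropy P (fun ω => (A i ω, Y ω)) - entropy P Y) := by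
  -- Masking with `none` outside s keeps the type independent of s, which permits induction on s.
  let R (s : Finset ι) (ω : Ω) : ι → Option α := fun i => if i ∈ s then some (A i ω) else none
  have R_congr : ∀ s ω ω', (∀ i ∈ s, A i ω = A i ω') → R s ω = R s ω' := by
    intro s ω ω' h
    funext i
    by_cases hi : i ∈ s
    · simp [R, hi, h i hi]
    · simp [R, hi]
  have congr_R : ∀ s ω ω', R s ω = R s ω' → ∀ i ∈ s, A i ω = A i ω' := by
    intro s ω ω' h i hi
    have := congrFun h i
    simpa [R, hi] using this
  have main : ∀ s : Finset ι, Observable (R s) ∧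
      entropy P (fun ω => (R s ω, Y ω)) - entropy P Y ≤
        ∑ i ∈ s, (entropy P (fun ω => (A i ω, Y ω)) - entropy P Y) := by
    intro s
    induction s using Finset.induction_on with
    | empty =>
      refine ⟨?_, ?_⟩
      · exact hY.factorsThrough fun ω ω' _ => R_congr _ _ _ (by simp)
      · have : entropy P (fun ω => (R ∅ ω, Y ω)) ≤ entropy P Y :=
          entropy_le_of_factorsThrough hY fun ω ω' h =>
            Prod.ext (R_congr ∅ ω ω' (by simp)) h
        simpa using this
    | insert i s hi ih =>
      obtain ⟨ho, ih⟩ := ih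
      refine ⟨?_, ?_⟩
      · refine ((hA i).prodMk ho).factorsThrough fun ω ω' h => R_congr _ _ _ fun j hj => ?_
        simp only [Prod.mk.injEq] at h
        rcases Finset.mem_insert.1 hj with rfl | hj
        · exact h.1
        · exact congr_R _ _ _ h.2 j hj
      · have := entropy_submodular (P := P) (B := fun ω => (R (insert i s) ω, Y ω)) (C := Y)
          ((hA i).prodMk hY) (ho.prodMk hY) (by
            intro ω ω' h h'
            simp only [Prod.mk.injEq] at h h' ⊢
            refine ⟨R_congr _ _ _ fun j hj => ?_, h.2⟩
            rcases Finset.mem_insert.1 hj with rfl | hj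
            · exact h.1
            · exact congr_R _ _ _ h'.1 j hj)
          (fun ω ω' h => (Prod.mk.inj h).2) (fun ω ω' h => (Prod.mk.inj h).2)
        rw [Finset.sum_insert hi]
        linarith
  obtain ⟨ho, h⟩ := main Finset.univ
  refine le_trans (sub_le_sub_right ?_ _) h
  refine entropy_le_of_factorsThrough (ho.prodMk hY) fun ω ω' h => ?_
  simp only [Prod.mk.injEq] at h ⊢
  exact ⟨funext fun i => congr_R _ _ _ h.1 i (Finset.mem_univ i), h.2⟩

end Entropy

/-! ### The lines, their intersections and their maximum -/

section Lines

theorem innerLine_last (N K : ℕ) (r : ℝ) : innerLine N K (K + 1) r = 1 - r := by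
  simp [innerLine]

/-- The line with index `i` in terms of the line with index `i + 1`. -/
theorem innerLine_eq_succ (N K k : ℕ) (hk : k + 1 < K) (r : ℝ) :
    innerLine N K (k + 2) r =
      (1 - r) + innerLine N K (k + 3) r / N - r * ((K : ℝ) - 1 - k) := by
  obtain ⟨m, rfl⟩ : ∃ m, K = k + 2 + m := ⟨K - (k + 2), by omega⟩
  have e1 : k + 2 + m + 2 - (k + 2) = m + 2 := by omega
  have e2 : k + 2 + m + 1 - (k + 2) = m + 1 := by omega
  have e3 : k + 2 + m + 2 - (k + 3) = m + 1 := by omega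
  have e4 : k + 2 + m + 1 - (k + 3) = m := by omega
  -- The terms j = 0 split off as (1 - r) and r (K - 1 - k); what remains of both sums is 1/N times
  -- the sums of the next line.
  rw [innerLine, innerLine, e1, e2, e3, e4, Finset.sum_range_succ' _ (m + 1),
    Finset.sum_range_succ' (fun j : ℕ =>
      (((k + 2 + m : ℕ) : ℝ) + 1 - (k + 2 : ℕ) - j) / (N : ℝ) ^ j) m, sub_div _ _ (N : ℝ),
    mul_div_assoc, mul_div_assoc, Finset.sum_div, Finset.sum_div]
  have h1 : ∀ n, ∑ j ∈ Finset.range n, 1 / (N : ℝ) ^ (j + 1) =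
      ∑ j ∈ Finset.range n, 1 / (N : ℝ) ^ j / N :=
    fun n => Finset.sum_congr rfl fun j _ => by rw [pow_succ, div_div]
  have h2 : ∑ j ∈ Finset.range m,
        (((k + 2 + m : ℕ) : ℝ) + 1 - (k + 2 : ℕ) - (j + 1 : ℕ)) / (N : ℝ) ^ (j + 1) =
      ∑ j ∈ Finset.range m, (((k + 2 + m : ℕ) : ℝ) + 1 - (k + 3 : ℕ) - j) / (N : ℝ) ^ j / N :=
    Finset.sum_congr rfl fun j _ => by
      rw [pow_succ, div_div]
      push_cast
      ring_nf
  rw [h1, h2]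
  push_cast
  ring

/-- Consecutive lines intersect at a corner. -/
theorem innerLine_sub_succ (N K s : ℕ) (hN : 1 ≤ N) (hs : s + 1 < K) (r : ℝ) :
    innerLine N K (s + 2) r - innerLine N K (s + 3) r =
      (1 - r * ∑ j ∈ Finset.range (K - (s + 1) + 1), (N : ℝ) ^ j) / (N : ℝ) ^ (K - (s + 1)) := by
  obtain ⟨m, rfl⟩ : ∃ m, K = s + 2 + m := ⟨K - (s + 2), by omega⟩
  have hN0 : (N : ℝ) ≠ 0 := by exact_mod_cast (by omega : N ≠ 0)
  induction m generalizing s with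
  | zero =>
    rw [innerLine_eq_succ _ _ _ hs]
    have : innerLine N (s + 2 + 0) (s + 3) r = 1 - r := innerLine_last N (s + 2) r
    have e : s + 2 + 0 - (s + 1) = 1 := by omega
    rw [this, e]
    simp only [Finset.sum_range_succ, Finset.range_zero, Finset.sum_empty]
    push_cast
    field_simp
    ring
  | succ m ih =>
    have hK : s + 1 + 2 + m = s + 2 + (m + 1) := by omega
    have h := ih (s + 1) (by omega)
    rw [hK] at h
    have h3 := innerLine_eq_succ N (s + 2 + (m + 1)) (s + 1) (by omega) r
    have a2 : s + 1 + 2 = s + 3 := by omega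
    have a3 : s + 1 + 3 = s + 4 := by omega
    have a4 : s + 2 + (m + 1) - (s + 1 + 1) = m + 1 := by omega
    have a5 : s + 2 + (m + 1) - (s + 1) = m + 2 := by omega
    rw [a2, a3] at h3 h
    rw [a4] at h
    -- Subtracting the recursions of two consecutive lines cancels 1 - r and leaves -r from the
    -- cache terms.
    have h2 : innerLine N (s + 2 + (m + 1)) (s + 2) r - innerLine N (s + 2 + (m + 1)) (s + 3) r =
        (innerLine N (s + 2 + (m + 1)) (s + 3) r - innerLine N (s + 2 + (m + 1)) (s + 4) r) / N
          - r := by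
      have h1 := innerLine_eq_succ N (s + 2 + (m + 1)) s hs r
      push_cast at h1 h3
      rw [sub_div]
      linarith
    rw [h2, a5, geom_sum_succ' (n := m + 2), h]
    generalize ∑ j ∈ Finset.range (m + 1 + 1), (N : ℝ) ^ j = z
    field_simp
    ring

theorem geom_pos (N n : ℕ) : 0 < ∑ j ∈ Finset.range (n + 1), (N : ℝ) ^ j := by
  rw [Finset.sum_range_succ']
  have : (0 : ℝ) ≤ ∑ j ∈ Finset.range n, (N : ℝ) ^ (j + 1) :=
    Finset.sum_nonneg fun _ _ => by positivity
  simp only [pow_zero]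
  linarith

theorem corner_lt_succ (N K s : ℕ) (hN : 1 ≤ N) (hs : s < K) :
    corner N K s < corner N K (s + 1) := by
  have h1 := geom_pos N (K - (s + 1))
  rcases Nat.eq_zero_or_pos s with rfl | hs0
  · simp only [corner, if_true, Nat.add_eq_zero_iff, one_ne_zero, and_false, if_false]
    positivity
  · rw [corner, corner, if_neg (by omega), if_neg (by omega)]
    refine one_div_lt_one_div_of_lt h1 ?_
    obtain ⟨m, rfl⟩ : ∃ m, K = s + 1 + m := ⟨K - (s + 1), by omega⟩
    rw [show s + 1 + m - s + 1 = m + 1 + 1 by omega, show s + 1 + m - (s + 1) + 1 = m + 1 by omega,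
      Finset.sum_range_succ _ (m + 1)]
    have : (0 : ℝ) < N := by exact_mod_cast hN
    have := pow_pos this (m + 1)
    linarith

theorem corner_mono (N K s t : ℕ) (hN : 1 ≤ N) (hst : s ≤ t) (ht : t ≤ K) :
    corner N K s ≤ corner N K t := by
  induction t, hst using Nat.le_induction with
  | base => exact le_rfl
  | succ t _ ih => exact (ih (by omega)).trans (corner_lt_succ N K t hN (by omega)).le

theorem innerLine_succ_le (N K s : ℕ) (hN : 1 ≤ N) (hs : s + 1 < K) (r : ℝ)
    (hr : r ≤ corner N K (s + 1)) : innerLine N K (s + 3) r ≤ innerLine N K (s + 2) r := by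
  have h := innerLine_sub_succ N K s hN hs r
  have hg := geom_pos N (K - (s + 1))
  rw [corner, if_neg (by omega), le_div_iff₀ hg] at hr
  have : 0 ≤ innerLine N K (s + 2) r - innerLine N K (s + 3) r := by
    rw [h]
    exact div_nonneg (by linarith) (by positivity)
  linarith

theorem innerLine_le_succ (N K s : ℕ) (hN : 1 ≤ N) (hs : s + 1 < K) (r : ℝ)
    (hr : corner N K (s + 1) ≤ r) : innerLine N K (s + 2) r ≤ innerLine N K (s + 3) r := by
  have h := innerLine_sub_succ N K s hN hs r
  have hg := geom_pos N (K - (s + 1))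
  rw [corner, if_neg (by omega), div_le_iff₀ hg] at hr
  have : innerLine N K (s + 2) r - innerLine N K (s + 3) r ≤ 0 := by
    rw [h]
    exact div_nonpos_of_nonpos_of_nonneg (by linarith) (by positivity)
  linarith

/-- Each comparison of neighbouring lines depends only on the side of their common corner on which r
lies. As the corners increase, the values at r rise with the index up to s + 2 and fall afterwards.
-/
theorem innerBound_eq (N K s : ℕ) (hN : 1 ≤ N) (hK : 1 ≤ K) (hs : s < K) (r : ℝ)
    (h1 : corner N K s ≤ r) (h2 : r ≤ corner N K (s + 1)) :
    innerBound N K hK r = innerLine N K (s + 2) r := by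
  have up : ∀ t, s ≤ t → t < K → innerLine N K (t + 2) r ≤ innerLine N K (s + 2) r := by
    intro t hst
    induction t, hst using Nat.le_induction with
    | base => exact fun _ => le_rfl
    | succ t hst ih =>
      intro ht
      exact (innerLine_succ_le N K t hN ht r
        (h2.trans (corner_mono N K _ _ hN (by omega) (by omega)))).trans (ih (by omega))
  have down : ∀ d t, t + d = s → innerLine N K (t + 2) r ≤ innerLine N K (s + 2) r := by
    intro d
    induction d with
    | zero =>
      rintro t rfl
      exact le_rfl
    | succ d ih =>
      intro t ht
      exact (innerLine_le_succ N K t hN (by omega) r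
        ((corner_mono N K (t + 1) s hN (by omega) (by omega)).trans h1)).trans
          (ih (t + 1) (by omega))
  refine le_antisymm (Finset.sup'_le _ _ fun i hi => ?_)
    (Finset.le_sup' (fun i => innerLine N K i r) (Finset.mem_Icc.2 ⟨by omega, by omega⟩))
  obtain ⟨hi1, hi2⟩ := Finset.mem_Icc.1 hi
  obtain ⟨t, rfl⟩ : ∃ t, i = t + 2 := ⟨i - 2, by omega⟩
  rcases le_total s t with h | h
  · exact up t h (by omega)
  · exact down (s - t) t (by omega)

theorem slope_lt (N K s : ℕ) (hN : 1 ≤ N) (hs : s + 1 < K) :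
    innerLine N K (s + 2) 1 - innerLine N K (s + 2) 0 <
      innerLine N K (s + 3) 1 - innerLine N K (s + 3) 0 := by
  have h1 := innerLine_sub_succ N K s hN hs 1
  have h0 := innerLine_sub_succ N K s hN hs 0
  have hg := geom_pos N (K - (s + 1))
  have hp : (0 : ℝ) < (N : ℝ) ^ (K - (s + 1)) := pow_pos (by exact_mod_cast hN) _
  have : innerLine N K (s + 2) 1 - innerLine N K (s + 3) 1 <
      innerLine N K (s + 2) 0 - innerLine N K (s + 3) 0 := by
    rw [h1, h0]
    exact div_lt_div_of_pos_right (by linarith) hp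
  linarith

end Lines

/-! ### Entropies attached to a scheme -/

namespace Scheme

variable {N K L c : ℕ} (S : Scheme N K L c)

/-- What the user knows before the answers arrive, apart from the cache content: the cached
positions and the queries. -/
def G (k : Fin K) (ω : S.Ω) : (Fin K → Fin c → Fin L) × (Fin N → Fin S.q) :=
  (S.idx ω, fun n => S.Q k n ω)

/-- All messages. -/
def Wall (ω : S.Ω) : Fin K → Fin L → Bool := fun i => S.W i ω

/-- The messages with index less than `t`; the others are blanked. -/
def V (t : ℕ) (ω : S.Ω) : Fin K → Fin L → Bool :=
  fun i => if (i : ℕ) < t then S.W i ω else fun _ => false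

/-- All answers. -/
def Aall (k : Fin K) (ω : S.Ω) : Fin N → Fin S.a := fun n => S.A k n ω

/-- The joint uncertainty about the answers of a user that knows the first `t` messages. -/
def answerEntropy (k : Fin K) (t : ℕ) : ℝ :=
  entropy S.P (fun ω => (S.Aall k ω, S.G k ω, S.Z ω, S.V t ω)) -
    entropy S.P (fun ω => (S.G k ω, S.Z ω, S.V t ω))

/-- The uncertainty about the answer of database `n` when its query and the first `t` messages
are known. -/
def localEntropy (k : Fin K) (n : Fin N) (t : ℕ) : ℝ :=
  entropy S.P (fun ω => (S.A k n ω, S.Q k n ω, S.V t ω)) -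
    entropy S.P (fun ω => (S.Q k n ω, S.V t ω))

/-- Every quantity below is a function of the messages, positions, queries and answers, so this
settles all measurability questions. -/
theorem observable_of {α : Type*} {X : S.Ω → α}
    (h : ∀ ω ω', (∀ i, S.W i ω = S.W i ω') → S.idx ω = S.idx ω' →
      (∀ k n, S.Q k n ω = S.Q k n ω') → (∀ k n, S.A k n ω = S.A k n ω') → X ω = X ω') :
    Observable X := by
  have hW : Observable (fun ω i => S.W i ω) :=
    .of_measurable (measurable_pi_lambda _ S.measurable_W)
  have hI : Observable S.idx := .of_measurable S.measurable_idx
  have hQ : Observable (fun ω k n => S.Q k n ω) :=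
    .of_measurable (measurable_pi_lambda _ fun k => measurable_pi_lambda _ (S.measurable_Q k))
  have hA : Observable (fun ω k n => S.A k n ω) :=
    .of_measurable (measurable_pi_lambda _ fun k => measurable_pi_lambda _ (S.measurable_A k))
  refine (hW.prodMk (hI.prodMk (hQ.prodMk hA))).factorsThrough fun ω ω' he => ?_
  simp only [Prod.mk.injEq, funext_iff] at he
  exact h ω ω' (fun i => funext fun j => he.1 i j) (funext fun i => funext fun j => he.2.1 i j)
    he.2.2.1 he.2.2.2

theorem V_congr {t : ℕ} {ω ω' : S.Ω} (h : ∀ i : Fin K, (i : ℕ) < t → S.W i ω = S.W i ω') :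
    S.V t ω = S.V t ω' := by
  funext i
  by_cases hi : (i : ℕ) < t
  · simp [V, hi, h i hi]
  · simp [V, hi]

theorem W_eq_of_V {t : ℕ} {ω ω' : S.Ω} (h : S.V t ω = S.V t ω') (i : Fin K) (hi : (i : ℕ) < t) :
    S.W i ω = S.W i ω' := by
  have := congrFun h i
  simpa [V, hi] using this

theorem V_eq_of_Wall {t : ℕ} {ω ω' : S.Ω} (h : S.Wall ω = S.Wall ω') : S.V t ω = S.V t ω' :=
  S.V_congr fun i _ => congrFun h i

theorem Z_eq {ω ω' : S.Ω} (h : S.Wall ω = S.Wall ω') (hi : S.idx ω = S.idx ω') :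
    S.Z ω = S.Z ω' := by
  funext i j
  have := congrFun h i
  simp only [Wall] at this
  simp [Z, this, hi]

theorem observable_Wall : Observable S.Wall := S.observable_of fun _ _ h _ _ _ => funext h

theorem observable_V (t : ℕ) : Observable (S.V t) :=
  S.observable_of fun _ _ h _ _ _ => S.V_congr fun i _ => h i

theorem observable_W (i : Fin K) : Observable (S.W i) := S.observable_of fun _ _ h _ _ _ => h i

theorem observable_Z : Observable S.Z :=
  S.observable_of fun _ _ h hi _ _ => S.Z_eq (funext h) hi

theorem observable_G (k : Fin K) : Observable (S.G k) :=
  S.observable_of fun _ _ _ hi hQ _ => Prod.ext hi (funext fun n => hQ k n)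

theorem observable_Q (k : Fin K) (n : Fin N) : Observable (S.Q k n) :=
  S.observable_of fun _ _ _ _ hQ _ => hQ k n

theorem observable_A (k : Fin K) (n : Fin N) : Observable (S.A k n) :=
  S.observable_of fun _ _ _ _ _ hA => hA k n

theorem observable_Aall (k : Fin K) : Observable (S.Aall k) :=
  S.observable_of fun _ _ _ _ _ hA => funext fun n => hA k n

theorem entropy_V (t : ℕ) (ht : t ≤ K) : entropy S.P (S.V t) = t * L := by
  induction t with
  | zero =>
    have : S.V 0 = fun _ => fun _ _ => false := by
      funext ω i
      simp [V]
    rw [this, entropy_const]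
    simp
  | succ t ih =>
    have hi : IndepFun (S.V t) (S.W ⟨t, ht⟩) S.P := by
      have h := S.indep_W.indepFun_finset (Finset.univ.filter fun i : Fin K => (i : ℕ) < t)
        {⟨t, ht⟩} (by simp) S.measurable_W
      have h' := h.comp
        (φ := fun f (i : Fin K) =>
          if hi : (i : ℕ) < t then f ⟨i, by simp [hi]⟩ else fun _ => false)
        (ψ := fun f => f ⟨⟨t, ht⟩, by simp⟩) (measurable_of_finite _) (measurable_of_finite _)
      have e : S.V t = (fun f (i : Fin K) => if hi : (i : ℕ) < t then f ⟨i, by simp [hi]⟩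
          else fun _ => false) ∘
          (fun ω (i : (Finset.univ.filter fun i : Fin K => (i : ℕ) < t)) => S.W i ω) := by
        funext ω i
        by_cases hi : (i : ℕ) < t <;> simp [V, hi]
      rw [e]
      exact h'
    have h := entropy_prod_of_indepFun (S.observable_V t) (S.observable_W _) hi
    rw [ih (by omega), S.entropy_W] at h
    rw [← entropy_eq_of_factorsThrough (X := S.V (t + 1))
      (Y := fun ω => (S.V t ω, S.W ⟨t, ht⟩ ω)) (S.observable_V _), h]
    · push_cast
      ring
    · intro ω ω' h
      exact Prod.ext (S.V_congr fun i hi => S.W_eq_of_V h i (by omega))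
        (S.W_eq_of_V h _ (Nat.lt_succ_self t))
    · intro ω ω' h
      simp only [Prod.mk.injEq] at h
      refine S.V_congr fun i hi => ?_
      rcases Nat.lt_succ_iff_lt_or_eq.1 hi with hi | hi
      · exact S.W_eq_of_V h.1 i hi
      · have : i = ⟨t, ht⟩ := Fin.ext hi
        rw [this]
        exact h.2

theorem entropy_Wall : entropy S.P S.Wall = K * L := by
  rw [← S.entropy_V K le_rfl]
  exact congrArg _ (funext fun ω => funext fun i => by simp [V, Wall])

theorem entropy_G_Wall (k : Fin K) :
    entropy S.P (fun ω => (S.G k ω, S.Wall ω)) = entropy S.P (S.G k) + K * L := by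
  rw [← S.entropy_Wall]
  exact entropy_prod_of_indepFun (S.observable_G k) S.observable_Wall (S.indep_query k)

theorem entropy_Q_Wall (k : Fin K) (n : Fin N) :
    entropy S.P (fun ω => (S.Q k n ω, S.Wall ω)) = entropy S.P (S.Q k n) + K * L := by
  rw [← S.entropy_Wall]
  exact entropy_prod_of_indepFun (S.observable_Q k n) S.observable_Wall
    ((S.indep_query k).comp (φ := fun g : (Fin K → Fin c → Fin L) × (Fin N → Fin S.q) => g.2 n)
      (ψ := id) (measurable_of_finite _) measurable_id)

theorem entropy_Q_V (k : Fin K) (n : Fin N) (t : ℕ) (ht : t ≤ K) :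
    entropy S.P (fun ω => (S.Q k n ω, S.V t ω)) = entropy S.P (S.Q k n) + t * L := by
  rw [← S.entropy_V t ht]
  exact entropy_prod_of_indepFun (S.observable_Q k n) (S.observable_V t)
    ((S.indep_query k).comp (φ := fun g : (Fin K → Fin c → Fin L) × (Fin N → Fin S.q) => g.2 n)
      (ψ := fun (w : Fin K → Fin L → Bool) (i : Fin K) =>
        if (i : ℕ) < t then w i else fun _ => false)
      (measurable_of_finite _) (measurable_of_finite _))

/-- Given the first `t` messages, the cache holds at most `c` bits of each of the others. -/
theorem entropy_G_Z_V_le (k : Fin K) (t : ℕ) (ht : t ≤ K) :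
    entropy S.P (fun ω => (S.G k ω, S.Z ω, S.V t ω)) ≤
      entropy S.P (S.G k) + t * L + (K - t) * c := by
  -- Only these cached bits are new: those of the first t messages are determined by the messages
  -- and the positions.
  let R : S.Ω → {i : Fin K // ¬ (i : ℕ) < t} → Fin c → Bool := fun ω i => S.Z ω i
  have hR : Observable R := S.observable_Z.comp fun z (i : {i : Fin K // ¬ (i : ℕ) < t}) => z i
  have h1 : entropy S.P R ≤ (K - t) * c := by
    refine (entropy_pi_bool_le hR).trans_eq ?_
    have : Fintype.card {i : Fin K // ¬ (i : ℕ) < t} = K - t := by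
      rw [Fintype.card_subtype_compl, Fintype.card_fin, Fintype.card_fin_lt_of_le ht]
    rw [this, Fintype.card_fin, Nat.cast_sub ht]
  have h2 := entropy_le_add (P := S.P) (B := fun ω => (S.G k ω, S.V t ω)) (S.observable_G k)
    (S.observable_V t) fun ω ω' h h' => Prod.ext h h'
  have h3 := entropy_le_add (P := S.P) (B := fun ω => (S.G k ω, S.Z ω, S.V t ω))
    ((S.observable_G k).prodMk (S.observable_V t)) hR fun ω ω' h h' => by
      simp only [Prod.mk.injEq] at h ⊢
      refine ⟨h.1, funext fun i => ?_, h.2⟩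
      by_cases hi : (i : ℕ) < t
      · funext j
        have h4 := S.W_eq_of_V h.2 i hi
        have h5 : S.idx ω = S.idx ω' := congrArg Prod.fst h.1
        simp [Z, h4, h5]
      · exact congrFun h' ⟨i, hi⟩
  rw [S.entropy_V t ht] at h2
  linarith

/-! ### The converse inequalities for a fixed message length -/

/-- Decoding: the answers carry the part of the desired message that is not cached. -/
theorem decoding_bound (k : Fin K) :
    (L : ℝ) - c - S.equivocation k + S.answerEntropy k (k + 1) ≤ S.answerEntropy k k := by
  have hG := S.observable_G k
  have hA := S.observable_Aall k
  have hZ := S.observable_Z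
  have heq : S.equivocation k =
      entropy S.P (fun ω => (S.W k ω, S.Z ω, S.G k ω, S.Aall k ω)) -
        entropy S.P (fun ω => (S.Aall k ω, S.G k ω, S.Z ω)) := by
    rw [equivocation, condEntropy_eq (S.observable_W k)]
    · congr 1
      · refine entropy_eq_of_factorsThrough
          ((S.observable_W k).prodMk (hZ.prodMk (hG.prodMk hA))) ?_ ?_ <;>
        · intro ω ω' h
          simp only [Prod.mk.injEq, G] at h ⊢
          tauto
      · refine entropy_eq_of_factorsThrough (hA.prodMk (hG.prodMk hZ)) ?_ ?_ <;>
        · intro ω ω' h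
          simp only [Prod.mk.injEq, G] at h ⊢
          tauto
    · refine (hA.prodMk (hG.prodMk hZ)).factorsThrough fun ω ω' h => ?_
      simp only [Prod.mk.injEq, G] at h ⊢
      tauto
  have V_succ : ∀ ω ω', S.W k ω = S.W k ω' → S.V k ω = S.V k ω' →
      S.V (k + 1) ω = S.V (k + 1) ω' := by
    intro ω ω' h h'
    refine S.V_congr fun i hi => ?_
    rcases Nat.lt_succ_iff_lt_or_eq.1 hi with hi | hi
    · exact S.W_eq_of_V h' i hi
    · rw [Fin.ext hi]
      exact h
  have V_pred : ∀ ω ω', S.V (k + 1) ω = S.V (k + 1) ω' → S.V k ω = S.V k ω' := fun ω ω' h =>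
    S.V_congr fun i hi => S.W_eq_of_V h i (by omega)
  -- Knowing the first k messages as well cannot raise the uncertainty about W k above the
  -- equivocation.
  have h1 := entropy_submodular (P := S.P)
    (X := fun ω => (S.W k ω, S.Z ω, S.G k ω, S.Aall k ω))
    (Y := fun ω => (S.Aall k ω, S.G k ω, S.Z ω, S.V k ω))
    (B := fun ω => (S.Aall k ω, S.G k ω, S.Z ω, S.V (k + 1) ω))
    (C := fun ω => (S.Aall k ω, S.G k ω, S.Z ω))
    ((S.observable_W k).prodMk (hZ.prodMk (hG.prodMk hA)))
    (hA.prodMk (hG.prodMk (hZ.prodMk (S.observable_V k))))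
    (fun ω ω' h h' => by
      simp only [Prod.mk.injEq] at h h' ⊢
      exact ⟨h'.1, h'.2.1, h'.2.2.1, V_succ _ _ h.1 h'.2.2.2⟩)
    (fun ω ω' h => by
      simp only [Prod.mk.injEq] at h ⊢
      tauto)
    (fun ω ω' h => by
      simp only [Prod.mk.injEq] at h ⊢
      tauto)
  -- For the lower bound L - c on the entropy of W k given G, Z and V k, all other messages are
  -- revealed too. They are independent of W k, and then only the c bits `S.Z ω k` of the cache
  -- still matter.
  let R : S.Ω → {i : Fin K // i ≠ k} → Fin L → Bool := fun ω i => S.W i ω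
  have hR : Observable R := S.observable_Wall.comp fun w (i : {i : Fin K // i ≠ k}) => w i
  have hZk : Observable (fun ω (_ : Unit) => S.Z ω k) := hZ.comp fun z _ => z k
  have h2 := entropy_submodular (P := S.P)
    (X := fun ω => (S.G k ω, S.Z ω, S.V (k + 1) ω))
    (Y := fun ω => (S.G k ω, S.Z ω, R ω))
    (B := fun ω => (S.G k ω, S.Wall ω))
    (C := fun ω => (S.G k ω, S.Z ω, S.V k ω))
    (hG.prodMk (hZ.prodMk (S.observable_V _))) (hG.prodMk (hZ.prodMk hR))
    (fun ω ω' h h' => by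
      simp only [Prod.mk.injEq] at h h' ⊢
      refine ⟨h.1, funext fun i => ?_⟩
      by_cases hi : i = k
      · rw [hi]
        exact S.W_eq_of_V h.2.2 k (Nat.lt_succ_self _)
      · exact congrFun h'.2.2 ⟨i, hi⟩)
    (fun ω ω' h => by
      simp only [Prod.mk.injEq] at h ⊢
      exact ⟨h.1, h.2.1, V_pred _ _ h.2.2⟩)
    (fun ω ω' h => by
      simp only [Prod.mk.injEq] at h ⊢
      refine ⟨h.1, h.2.1, S.V_congr fun i hi => congrFun h.2.2 ⟨i, ?_⟩⟩
      rintro rfl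
      exact lt_irrefl _ hi)
  have h3 := entropy_le_add (P := S.P) (B := fun ω => (S.G k ω, R ω)) hG hR
    fun ω ω' h h' => Prod.ext h h'
  have h4 := entropy_le_add (P := S.P) (B := fun ω => (S.G k ω, S.Z ω, R ω)) (hG.prodMk hR) hZk
    fun ω ω' h h' => by
      simp only [Prod.mk.injEq] at h ⊢
      refine ⟨h.1, funext fun i => ?_, h.2⟩
      by_cases hi : i = k
      · rw [hi]
        exact congrFun h' ()
      · have h5 : S.W i ω = S.W i ω' := congrFun h.2 ⟨i, hi⟩
        have h6 : S.idx ω = S.idx ω' := congrArg Prod.fst h.1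
        funext j
        simp [Z, h5, h6]
  have h5 := entropy_pi_bool_le (P := S.P) hR
  have h6 := entropy_pi_bool_le (P := S.P) hZk
  have h7 : (Fintype.card {i : Fin K // i ≠ k} : ℝ) = K - 1 := by
    have hK : 1 ≤ K := k.pos
    rw [Fintype.card_subtype_compl, Fintype.card_fin, Fintype.card_unique, Nat.cast_sub hK,
      Nat.cast_one]
  rw [h7, Fintype.card_fin] at h5
  rw [Fintype.card_unique, Fintype.card_fin, Nat.cast_one, one_mul] at h6
  rw [S.entropy_G_Wall] at h2
  rw [heq, answerEntropy, answerEntropy]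
  linarith

theorem answerEntropy_nonneg (k : Fin K) (t : ℕ) : 0 ≤ S.answerEntropy k t :=
  sub_nonneg.2 (entropy_comp_le ((S.observable_Aall k).prodMk ((S.observable_G k).prodMk
    (S.observable_Z.prodMk (S.observable_V t)))) Prod.snd)

theorem localEntropy_le (k : Fin K) (n : Fin N) (t : ℕ) :
    S.localEntropy k n t ≤ entropy S.P (S.A k n) :=
  sub_le_iff_le_add.2 (entropy_le_add (S.observable_A k n)
    ((S.observable_Q k n).prodMk (S.observable_V t)) fun _ _ h h' => Prod.ext h h')

/-- Subadditivity over the databases; dropping the cache, the positions and the other queries from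
the conditioning only increases each term. -/
theorem answerEntropy_le_sum (k : Fin K) (t : ℕ) :
    S.answerEntropy k t ≤ ∑ n, S.localEntropy k n t := by
  have hC : Observable (fun ω => (S.G k ω, S.Z ω, S.V t ω)) :=
    (S.observable_G k).prodMk (S.observable_Z.prodMk (S.observable_V t))
  refine (entropy_pi_sub_le (S.observable_A k) hC).trans (Finset.sum_le_sum fun n _ => ?_)
  have := entropy_submodular (P := S.P) (B := fun ω => (S.A k n ω, S.G k ω, S.Z ω, S.V t ω))
    (C := fun ω => (S.Q k n ω, S.V t ω))
    (X := fun ω => (S.A k n ω, S.Q k n ω, S.V t ω)) (Y := fun ω => (S.G k ω, S.Z ω, S.V t ω))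
    ((S.observable_A k n).prodMk ((S.observable_Q k n).prodMk (S.observable_V t))) hC
    (fun ω ω' h h' => Prod.ext (Prod.mk.inj h).1 h')
    (fun ω ω' h => congrArg Prod.snd h)
    (fun ω ω' h => Prod.ext (congrArg (fun x => x.1.2 n) h) (congrArg (fun x => x.2.2) h))
  rw [localEntropy]
  linarith

theorem answerEntropy_le_downloadCost (k : Fin K) (t : ℕ) :
    S.answerEntropy k t ≤ S.downloadCost k :=
  (S.answerEntropy_le_sum k t).trans (Finset.sum_le_sum fun n _ => S.localEntropy_le k n t)

/-- A single answer is, up to the cached part of the unknown messages, as uncertain to the user as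
to its database. -/
theorem localEntropy_le_answerEntropy (k : Fin K) (n : Fin N) (t : ℕ) (ht : t ≤ K) :
    S.localEntropy k n t - (K - t) * c ≤ S.answerEntropy k t := by
  have hG := S.observable_G k
  have hA := S.observable_A k n
  have hQ := S.observable_Q k n
  have hW := S.observable_Wall
  have hV := S.observable_V t
  have hQG : ∀ ω ω', S.G k ω = S.G k ω' → S.Q k n ω = S.Q k n ω' := fun ω ω' h =>
    congrArg (fun x => x.2 n) h
  have h1 : entropy S.P (fun ω => (S.A k n ω, S.G k ω, S.V t ω)) ≤
      entropy S.P (fun ω => (S.Aall k ω, S.G k ω, S.Z ω, S.V t ω)) :=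
    entropy_comp_le (f := fun x => (x.1 n, x.2.1, x.2.2.2)) ((S.observable_Aall k).prodMk
      (hG.prodMk (S.observable_Z.prodMk hV)))
  have h2 := S.entropy_G_Z_V_le k t ht
  -- Given Q n and the first t messages, the answer is conditionally independent of the positions
  -- and the other queries, because it is a function of Q n and the messages and these are
  -- independent of G.
  have h3 := entropy_submodular (P := S.P)
    (X := fun ω => (S.A k n ω, S.G k ω, S.V t ω)) (Y := fun ω => (S.A k n ω, S.Q k n ω, S.Wall ω))
    (B := fun ω => (S.G k ω, S.Wall ω)) (C := fun ω => (S.A k n ω, S.Q k n ω, S.V t ω))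
    (hA.prodMk (hG.prodMk hV)) (hA.prodMk (hQ.prodMk hW))
    (fun ω ω' h h' => by
      simp only [Prod.mk.injEq] at h h' ⊢
      exact ⟨h.2.1, h'.2.2⟩)
    (fun ω ω' h => by
      simp only [Prod.mk.injEq] at h ⊢
      exact ⟨h.1, hQG _ _ h.2.1, h.2.2⟩)
    (fun ω ω' h => by
      simp only [Prod.mk.injEq] at h ⊢
      exact ⟨h.1, h.2.1, S.V_eq_of_Wall h.2.2⟩)
  have h4 : entropy S.P (fun ω => (S.A k n ω, S.Q k n ω, S.Wall ω)) =
      entropy S.P (S.Q k n) + K * L := by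
    have : condEntropy S.P (S.A k n) (fun ω => (S.Q k n ω, S.Wall ω)) = 0 := S.answer k n
    rw [condEntropy_eq hA (hQ.prodMk hW), sub_eq_zero] at this
    rw [← S.entropy_Q_Wall k n]
    exact this
  have h5 := S.entropy_Q_V k n t ht
  rw [S.entropy_G_Wall] at h3
  rw [localEntropy, answerEntropy]
  linarith

/-- The one place where privacy enters. The law must include the messages, since the entropy is
conditioned on some of them. -/
theorem localEntropy_eq (k k' : Fin K) (n : Fin N) (t : ℕ) :
    S.localEntropy k n t = S.localEntropy k' n t := by
  have h := S.privacy n k k'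
  have h1 := h.comp (u := fun x => (x.2.1, x.1,
    fun i : Fin K => if (i : ℕ) < t then x.2.2 i else fun _ => false)) (measurable_of_finite _)
  have h2 := h.comp (u := fun x => (x.1,
    fun i : Fin K => if (i : ℕ) < t then x.2.2 i else fun _ => false)) (measurable_of_finite _)
  exact congrArg₂ (· - ·) (entropy_eq_of_identDistrib h1) (entropy_eq_of_identDistrib h2)

theorem equivocation_nonneg (k : Fin K) : 0 ≤ S.equivocation k :=
  condEntropy_nonneg (S.observable_W k) (S.observable_of fun ω ω' h hi hQ hA => by
    simp only [Prod.mk.injEq]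
    exact ⟨S.Z_eq (funext h) hi, hi, funext fun n => hQ k n, funext fun n => hA k n⟩)

/-- The uncertainty about the answers at one stage, in terms of the next stage. -/
theorem answerEntropy_recursion (hN : 1 ≤ N) (k : Fin K) (hk : (k : ℕ) + 1 < K) :
    ((L : ℝ) - c - S.equivocation ⟨k + 1, hk⟩ + S.answerEntropy ⟨k + 1, hk⟩ (k + 2)) / N
      - (K - 1 - k) * c ≤ S.answerEntropy k (k + 1) := by
  have h1 := S.decoding_bound ⟨k + 1, hk⟩
  have h2 := S.answerEntropy_le_sum ⟨k + 1, hk⟩ (k + 1)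
  -- Each of the N local entropies is moved to demand k by privacy and bounded by the same T_k(k+1);
  -- dividing by N later gives the factor 1/N.
  have h3 : ∑ n, S.localEntropy ⟨k + 1, hk⟩ n (k + 1) ≤
      ∑ _n : Fin N, (S.answerEntropy k (k + 1) + (K - 1 - k) * c) := by
    refine Finset.sum_le_sum fun n _ => ?_
    rw [S.localEntropy_eq _ k]
    have := S.localEntropy_le_answerEntropy k n (k + 1) hk.le
    push_cast at this
    linarith
  rw [Finset.sum_const, Finset.card_univ, Fintype.card_fin, nsmul_eq_mul] at h3
  have hN0 : (0 : ℝ) < N := by exact_mod_cast hN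
  rw [sub_le_iff_le_add, div_le_iff₀ hN0]
  simp only at h1
  linarith

/-- The bound for a finite message length. -/
theorem innerLine_mul_le (hN : 1 ≤ N) {r : ℝ} (hc : (c : ℝ) ≤ r * L) (m : ℕ) :
    ∀ k : Fin K, (k : ℕ) + m + 1 = K →
      L * innerLine N K (k + 2) r - ∑ i : Fin K with k < i, S.equivocation i ≤
        L - c + S.answerEntropy k (k + 1) := by
  have hN0 : (0 : ℝ) < N := by exact_mod_cast hN
  induction m with
  | zero =>
    intro k hk
    have h0 := S.answerEntropy_nonneg k (k + 1)
    have h1 : innerLine N K (k + 2) r = 1 - r := by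
      have e : (k : ℕ) + 2 = K + 1 := by omega
      rw [e, innerLine_last]
    have h2 : 0 ≤ ∑ i : Fin K with k < i, S.equivocation i :=
      Finset.sum_nonneg fun i _ => S.equivocation_nonneg i
    rw [h1]
    linarith
  | succ m ih =>
    intro k hk
    have hk' : (k : ℕ) + 1 < K := by omega
    have h1 := ih ⟨k + 1, hk'⟩ (by simp only; omega)
    have h2 := S.answerEntropy_recursion hN k hk'
    rw [innerLine_eq_succ N K k hk']
    simp only at h1
    have e : k + 1 + 2 = (k : ℕ) + 3 := by omega
    have e' : k + 1 + 1 = (k : ℕ) + 2 := by omega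
    rw [e, e'] at h1
    have h3 : ∑ i : Fin K with k < i, S.equivocation i = S.equivocation ⟨k + 1, hk'⟩ +
        ∑ i : Fin K with (⟨k + 1, hk'⟩ : Fin K) < i, S.equivocation i := by
      have : (Finset.univ.filter fun i : Fin K => k < i) =
          insert ⟨k + 1, hk'⟩ (Finset.univ.filter fun i : Fin K => ⟨k + 1, hk'⟩ < i) := by
        ext i
        simp only [Finset.mem_filter, Finset.mem_univ, true_and, Finset.mem_insert, Fin.lt_def,
          Fin.ext_iff]
        omega
      rw [this, Finset.sum_insert (by simp)]
    have h4 : 0 ≤ ∑ i : Fin K with k < i, S.equivocation i :=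
      Finset.sum_nonneg fun i _ => S.equivocation_nonneg i
    set E := ∑ i : Fin K with k < i, S.equivocation i
    have h5 : (L * innerLine N K (k + 3) r - E) / N ≤
        ((L : ℝ) - c - S.equivocation ⟨k + 1, hk'⟩ + S.answerEntropy ⟨k + 1, hk'⟩ (k + 2)) / N :=
      div_le_div_of_nonneg_right (by linarith) hN0.le
    -- The recursion discounts later equivocations by powers of 1/N; the discount is given up, as
    -- the total is o(L) anyway.
    have h6 : E / N ≤ E := div_le_self h4 (by exact_mod_cast hN)
    have h7 : ((K : ℝ) - 1 - k) * c ≤ (K - 1 - k) * (r * L) := by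
      refine mul_le_mul_of_nonneg_left hc ?_
      have : ((k : ℕ) : ℝ) + 1 < K := by exact_mod_cast hk'
      linarith
    rw [sub_div] at h5
    have h8 : (L : ℝ) * (1 - r + innerLine N K (k + 3) r / N - r * (K - 1 - k)) =
      L - r * L + L * innerLine N K (k + 3) r / N - (K - 1 - k) * (r * L) := by ring
    rw [h8]
    linarith

/-- One more decoding step, for message k itself, followed by T_k(k) ≤ D. -/
theorem innerLine_mul_le_downloadCost (hN : 1 ≤ N) {r : ℝ} (hc : (c : ℝ) ≤ r * L) (k : Fin K) :
    L * innerLine N K (k + 2) r - ∑ i, S.equivocation i ≤ S.downloadCost k := by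
  have h1 := S.innerLine_mul_le hN hc (K - 1 - k) k (by omega)
  have h2 := S.decoding_bound k
  have h3 := S.answerEntropy_le_downloadCost k k
  have h4 : S.equivocation k + ∑ i : Fin K with k < i, S.equivocation i ≤
      ∑ i, S.equivocation i := by
    rw [← Finset.sum_insert (s := Finset.univ.filter fun i : Fin K => k < i) (by simp)]
    exact Finset.sum_le_sum_of_subset_of_nonneg (Finset.subset_univ _)
      fun i _ _ => S.equivocation_nonneg i
  linarith

end Scheme

/-! ### Passage to the limit and the bound on the optimal cost -/

theorem innerLine_le_of_achievable {N K : ℕ} (hN : 1 ≤ N) {r d : ℝ} (hr : 0 ≤ r)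
    (h : Achievable N K r d) (k : Fin K) : innerLine N K (k + 2) r ≤ d := by
  obtain ⟨L, S, hL, he, hd⟩ := h
  have h1 : Tendsto (fun m => innerLine N K (k + 2) r -
      ∑ i, (S m).equivocation i / (L m : ℝ)) atTop (𝓝 (innerLine N K (k + 2) r)) := by
    simpa using tendsto_const_nhds.sub (tendsto_finsetSum Finset.univ fun i _ => he i)
  refine le_of_tendsto_of_tendsto h1 (hd k) ?_
  filter_upwards [hL.eventually_gt_atTop 0] with m hm
  have hm0 : (0 : ℝ) < L m := by exact_mod_cast hm
  -- Rounding down makes the number of cached bits at most r L, which is the direction needed.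
  have h2 := (S m).innerLine_mul_le_downloadCost hN
    (Nat.floor_le (mul_nonneg hr hm0.le)) k
  rw [le_div_iff₀ hm0, sub_mul, ← Finset.sum_div, div_mul_cancel₀ _ hm0.ne']
  linarith

theorem innerBound_le_optimalCost (N K : ℕ) (hN : 1 ≤ N) (hK : 1 ≤ K) (r : ℝ) (hr : 0 ≤ r) :
    (innerBound N K hK r : EReal) ≤ optimalCost N K r := by
  refine le_sInf ?_
  rintro _ ⟨d, hd, rfl⟩
  refine EReal.coe_le_coe_iff.2 (Finset.sup'_le _ _ fun i hi => ?_)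
  obtain ⟨h1, h2⟩ := Finset.mem_Icc.1 hi
  obtain ⟨k, rfl⟩ : ∃ k, i = k + 2 := ⟨i - 2, by omega⟩
  exact innerLine_le_of_achievable hN hr hd ⟨k, by omega⟩

end CachePIR

end

theorem theorem2 (N K : ℕ) (hN : 1 ≤ N) (hK : 1 ≤ K) :
    -- the lower bound on the optimal normalized download cost
    (∀ r : ℝ, 0 ≤ r → r ≤ 1 →
      (CachePIR.innerBound N K hK r : EReal) ≤ CachePIR.optimalCost N K r) ∧
    -- the bound is linear on each of `K` consecutive segments that partition `[0, 1]`
    CachePIR.corner N K 0 = 0 ∧ CachePIR.corner N K K = 1 ∧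
    (∀ s : ℕ, s < K → CachePIR.corner N K s < CachePIR.corner N K (s + 1) ∧
      ∀ r : ℝ, CachePIR.corner N K s ≤ r → r ≤ CachePIR.corner N K (s + 1) →
        CachePIR.innerBound N K hK r = CachePIR.innerLine N K (s + 2) r) ∧
    -- the slopes of consecutive segments differ: the descent gets strictly less steep
    (∀ s : ℕ, s + 1 < K →
      CachePIR.innerLine N K (s + 2) 1 - CachePIR.innerLine N K (s + 2) 0 <
        CachePIR.innerLine N K (s + 3) 1 - CachePIR.innerLine N K (s + 3) 0) := by
  refine ⟨fun r hr _ => CachePIR.innerBound_le_optimalCost N K hN hK r hr, by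
    simp [CachePIR.corner], ?_, fun s hs => ⟨CachePIR.corner_lt_succ N K s hN hs,
      CachePIR.innerBound_eq N K s hN hK hs⟩, fun s => CachePIR.slope_lt N K s hN⟩
  rw [CachePIR.corner, if_neg (by omega)]
  simp
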